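/- All matroids are finite. For a matroid $M$ with ground set $E$, write $|M|=|E|$, let $\operatorname{rk}(A)$ denote the rank of $A\subseteq E$, let $\ell(A)=|A|-\operatorname{rk}(A)$ be its corank, and let $c(M)$ be the number of connected components of $M$, that is, the largest integer $k$ such that $M$ is a direct sum $M_1\oplus\dots\oplus M_k$ of non-empty matroids ($c=0$ for the empty matroid). For $A\subseteq E$ put $c(A)=c(M|A)$, where $M|A$ is the restriction of $M$ to $A$. Let $\beta(M)=(-1)^{\operatorname{rk}(M)}\sum_{A\subseteq E}(-1)^{|A|}\operatorname{rk}(A)$ be Crapo's invariant. A matroid is graphic if it is the cycle matroid of a finite graph (self-loops and multiple edges are allowed), and cographic if its dual is graphic. Consider the identities $$c(M)=|M|-\sum_{A\subseteq B\subseteq E}(-1)^{|B|-|A|}\,\ell(A)\operatorname{rk}(B),\tag{1}$$ $$\beta(M)\operatorname{rk}(M)=(-1)^{\operatorname{rk}(M)}\sum_{A\subseteq E}(-1)^{|A|}c(A).\tag{2}$$ **Theorem.** Identity (1) holds for every matroid $M$ that is graphic or cographic. Moreover, for an arbitrary finite matroid $M$: - (1) holds for all restrictions $M|R$, $R\subseteq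 E$, if and only if (2) holds for all restrictions $M|R$ with $R\subseteq E$ and $|R|\ge 2$; - (1) holds for $M$ if and only if it holds for the dual matroid $M^\star$. -/

import Mathlib

open scoped Function

/-- `C` is the edge set of a cycle of the multigraph `G`: there are pairwise distinct vertices
`v 0, …, v n` and pairwise distinct edges `e 0, …, e n` with union `C`, such that `e i` joins
`v i` to `v (i + 1)`, the index `i + 1` being taken modulo `n + 1`. The case `n = 0` is a self-loop,
the case `n = 1` is a pair of parallel edges. -/
def Graph.IsCycleEdgeSet {V α : Type*} (G : Graph V α) (C : Set α) : Prop :=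
  ∃ (n : ℕ) (v : Fin (n + 1) → V) (e : Fin (n + 1) → α),
    Function.Injective v ∧ Function.Injective e ∧
      (∀ i, G.IsLink (e i) (v i) (v (i + 1))) ∧ C = Set.range e

/-- `M` is the cycle matroid of `G`: its elements are the edges of `G`, and its circuits are the
edge sets of the cycles of `G`. -/
def Matroid.IsCycleMatroidOf {V α : Type*} (M : Matroid α) (G : Graph V α) : Prop :=
  M.E = G.edgeSet ∧ ∀ C : Set α, M.IsCircuit C ↔ G.IsCycleEdgeSet C

/-- `M` is graphic: it is the cycle matroid of a finite multigraph, whose vertices we may label by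
natural numbers. -/
def Matroid.IsGraphic {α : Type*} (M : Matroid α) : Prop :=
  ∃ G : Graph ℕ α, G.vertexSet.Finite ∧ G.edgeSet.Finite ∧ M.IsCycleMatroidOf G

/-- `M` is cographic: its dual is graphic. -/
def Matroid.IsCographic {α : Type*} (M : Matroid α) : Prop :=
  (M.dual).IsGraphic

/-- `M` is the direct sum of `k` non-empty matroids. -/
def Matroid.IsDirectSumOfNonempty {α : Type*} (M : Matroid α) (k : ℕ) : Prop :=
  ∃ (N : Fin k → Matroid α) (h : Pairwise (Disjoint on fun i ↦ (N i).E)),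
    (∀ i, (N i).Nonempty) ∧ M = Matroid.disjointSigma N h

/-- The number `c(M)` of connected components of a finite matroid: the largest `k` such that `M` is
the direct sum of `k` non-empty matroids. -/
noncomputable def Matroid.numComponents {α : Type*} (M : Matroid α) : ℕ :=
  sSup {k : ℕ | M.IsDirectSumOfNonempty k}

/-- For a finite matroid the maximum in the definition of `c(M)` exists. -/
theorem Matroid.isGreatest_numComponents {α : Type*} (M : Matroid α) [M.Finite] :
    IsGreatest {k : ℕ | M.IsDirectSumOfNonempty k} M.numComponents := by
  have hbdd : BddAbove {k : ℕ | M.IsDirectSumOfNonempty k} := by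
    refine ⟨M.E.ncard, ?_⟩
    rintro k ⟨N, h, hne, rfl⟩
    choose x hx using fun i ↦ (hne i).ground_nonempty
    have hinj : Function.Injective x := by
      intro i j hij
      by_contra hne'
      exact Set.disjoint_left.1 (h hne') (hx i) (hij ▸ hx j)
    have hsub : Set.range x ⊆ (Matroid.disjointSigma N h).E := by
      rintro _ ⟨i, rfl⟩
      rw [Matroid.disjointSigma_ground_eq]
      exact Set.mem_iUnion.2 ⟨i, hx i⟩
    have := Set.ncard_le_ncard hsub (Matroid.ground_finite _)
    rwa [← Set.image_univ, Set.ncard_image_of_injective _ hinj, Set.ncard_univ,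
      Nat.card_fin] at this
  have hne : {k : ℕ | M.IsDirectSumOfNonempty k}.Nonempty := by
    rcases M.E.eq_empty_or_nonempty with h | h
    · have hd : Pairwise (Disjoint on fun i ↦ ((fun _ ↦ M : Fin 0 → Matroid α) i).E) :=
        fun i ↦ i.elim0
      refine ⟨0, fun _ ↦ M, hd, fun i ↦ i.elim0, ?_⟩
      refine Matroid.ext_indep ?_ fun I hI ↦ ?_
      · rw [Matroid.disjointSigma_ground_eq, h, Set.iUnion_of_empty]
      · have hI0 : I = ∅ := Set.subset_empty_iff.1 (h ▸ hI)
        rw [Matroid.disjointSigma_indep_iff, hI0]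
        simp
    · have hd : Pairwise (Disjoint on fun i ↦ ((fun _ ↦ M : Fin 1 → Matroid α) i).E) :=
        fun i j hij ↦ (hij (Subsingleton.elim i j)).elim
      refine ⟨1, fun _ ↦ M, hd, fun _ ↦ ⟨h⟩, ?_⟩
      refine Matroid.ext_indep ?_ fun I hI ↦ ?_
      · rw [Matroid.disjointSigma_ground_eq, Set.iUnion_const]
      · rw [Matroid.disjointSigma_indep_iff, Set.iUnion_const, Set.inter_eq_left.2 hI]
        simp [hI]
  exact ⟨Nat.sSup_mem hne hbdd, fun k hk ↦ le_csSup hbdd hk⟩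

/-- The rank of a set of elements, as a natural number (for matroids of finite rank). -/
noncomputable def Matroid.rkNat {α : Type*} (M : Matroid α) (A : Set α) : ℕ :=
  (M.eRk A).toNat

/-- The corank `ℓ(A) = |A| - rk(A)` of a finite set of elements. -/
noncomputable def Matroid.corank {α : Type*} (M : Matroid α) (A : Finset α) : ℤ :=
  (A.card : ℤ) - (M.rkNat A : ℤ)

/-- The set of elements of a finite matroid as a `Finset`. -/
noncomputable def Matroid.elements {α : Type*} (M : Matroid α) [M.Finite] : Finset α :=
  M.ground_finite.toFinset

instance Matroid.finite_restrict_finset {α : Type*} (M : Matroid α) (R : Finset α) :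
    (M.restrict (R : Set α)).Finite :=
  Matroid.restrict_finite R.finite_toSet

/-- Crapo's invariant `β(M) = (-1)^rk(M) ∑_{A ⊆ M} (-1)^|A| rk(A)`. -/
noncomputable def Matroid.crapoBeta {α : Type*} (M : Matroid α) [M.Finite] : ℤ :=
  (-1) ^ M.rkNat M.E * ∑ A ∈ M.elements.powerset, (-1) ^ A.card * (M.rkNat A : ℤ)

/-- The identity `c(M) = |M| - ∑_{A ⊆ B ⊆ M} (-1)^(|B| - |A|) ℓ(A) rk(B)`. -/
def Matroid.ComponentIdentity {α : Type*} (M : Matroid α) [M.Finite] : Prop :=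
  (M.numComponents : ℤ) = (M.elements.card : ℤ) -
    ∑ B ∈ M.elements.powerset, ∑ A ∈ B.powerset,
      (-1) ^ (B.card - A.card) * M.corank A * (M.rkNat B : ℤ)

/-- The identity `β(M) rk(M) = (-1)^rk(M) ∑_{A ⊆ M} (-1)^|A| c(A)`, where `c(A)` is the number of
connected components of the restriction of `M` to `A`. -/
def Matroid.BetaRankIdentity {α : Type*} (M : Matroid α) [M.Finite] : Prop :=
  M.crapoBeta * (M.rkNat M.E : ℤ) = (-1) ^ M.rkNat M.E *
    ∑ A ∈ M.elements.powerset, (-1) ^ A.card * ((M.restrict (A : Set α)).numComponents : ℤ)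

/-! Write `b(R)` for the sum of `(-1)^|A| rk(A)` over `A ⊆ R`; up to sign it is `β(M|R)`.

Equivalence (`forall_componentIdentity_iff`). Let `D(R)` be the defect of (1) for `M|R`. It contains
a sum over `B ⊆ R` of terms `k(B)`, so its alternating sum over the subsets of `R` isolates `k(R)`.
For `|R| ≥ 2` the alternating sum of cardinalities vanishes, `ℓ` contributes `-b(R)`, and the result
is the defect of (2) for `M|R` up to sign. By Möbius inversion `D` vanishes on all subsets exactly
when its alternating sums do. Sets with fewer than two elements always satisfy (1).

Duality (`ComponentIdentity.dual`). Complementation reverses inclusions and exchanges, up to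
constants and signs, `ℓ` and `rk` of the dual with `rk` and `ℓ` of `M`; the constant terms cancel.
This reduces cographic to graphic.

Graphic matroids (`numComponents_restrict_eq`). A loopless connected set of edges meets `rk + 1`
vertices, and deleting one of these vertices lowers the rank by exactly one. Summing over
components, `c(A)` is the number of loops in `A`, minus `rk(A)`, plus the sum over vertices `v` of
`rk(A) - rk(A - v)`, where `A - v` drops the edges at `v`. In the alternating sum over `A ⊆ R` the
loops vanish, and so does `rk(A - v)` whenever `v` meets `R`. What remains is `b(R)` times the
number of vertices met by `R` minus one. That factor is `rk(R)` if `R` is connected, and otherwise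
`b(R) = 0`. This is (2). -/

/-! ### Alternating sums over subsets and Möbius inversion. -/

section AlternatingSums

variable {α : Type*}

theorem Finset.sum_powerset_alternating_insert [DecidableEq α] {R : Finset α} {e : α} (he : e ∉ R)
    (g : Finset α → ℤ) :
    ∑ A ∈ (insert e R).powerset, (-1) ^ A.card * g A =
      ∑ A ∈ R.powerset, (-1) ^ A.card * (g A - g (insert e A)) := by
  rw [Finset.sum_powerset_insert he, ← Finset.sum_add_distrib]
  refine Finset.sum_congr rfl fun A hA ↦ ?_
  have : e ∉ A := fun h ↦ he (Finset.mem_powerset.1 hA h)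
  rw [Finset.card_insert_of_notMem this]
  ring

/-- The terms of `A` and `insert e A` cancel. Most of the later vanishing statements come from this.
-/
theorem Finset.sum_powerset_alternating_eq_zero [DecidableEq α] {R : Finset α} {e : α} (he : e ∈ R)
    (g : Finset α → ℤ) (h : ∀ A ⊆ R.erase e, g (insert e A) = g A) :
    ∑ A ∈ R.powerset, (-1) ^ A.card * g A = 0 := by
  rw [← Finset.insert_erase he, Finset.sum_powerset_alternating_insert (Finset.notMem_erase e R)]
  refine Finset.sum_eq_zero fun A hA ↦ ?_
  rw [h A (Finset.mem_powerset.1 hA)]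
  ring

theorem Finset.sum_powerset_alternating_card_filter {R : Finset α} (hR : 2 ≤ R.card)
    (p : α → Prop) [DecidablePred p] :
    ∑ A ∈ R.powerset, (-1 : ℤ) ^ A.card * ((A.filter p).card : ℤ) = 0 := by
  classical
  -- Count element by element: whether `l ∈ A` is unaffected by adding some `e ≠ l`, which exists
  -- because `R` has two elements.
  have key : ∀ l ∈ R, ∑ A ∈ R.powerset, (-1 : ℤ) ^ A.card * (if l ∈ A ∧ p l then 1 else 0) = 0 := by
    intro l _
    obtain ⟨e, heR, hel⟩ := Finset.exists_mem_ne (by omega : 1 < R.card) l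
    refine Finset.sum_powerset_alternating_eq_zero heR (fun A ↦ if l ∈ A ∧ p l then 1 else 0)
      fun A _ ↦ ?_
    simp [Finset.mem_insert, hel.symm]
  rw [← Finset.sum_eq_zero key, Finset.sum_comm]
  refine Finset.sum_congr rfl fun A hA ↦ ?_
  rw [← Finset.mul_sum, Finset.card_filter, Nat.cast_sum]
  congr 1
  rw [← Finset.sum_subset (Finset.mem_powerset.1 hA)]
  · refine Finset.sum_congr rfl fun l hl ↦ ?_
    simp [hl]
  · intro l _ hl
    simp [hl]

theorem Finset.sum_powerset_alternating_card {R : Finset α} (hR : 2 ≤ R.card) :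
    ∑ A ∈ R.powerset, (-1 : ℤ) ^ A.card * (A.card : ℤ) = 0 := by
  simpa using Finset.sum_powerset_alternating_card_filter hR (fun _ ↦ True)

/-- Möbius inversion over the subsets of a finite set. -/
theorem Finset.sum_powerset_alternating_sum_powerset (R : Finset α) (k : Finset α → ℤ) :
    ∑ A ∈ R.powerset, (-1) ^ A.card * ∑ B ∈ A.powerset, k B = (-1) ^ R.card * k R := by
  classical
  induction R using Finset.induction_on generalizing k with
  | empty => simp
  | insert e R he ih =>
    rw [Finset.sum_powerset_alternating_insert he, Finset.card_insert_of_notMem he, pow_succ,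
      mul_neg_one, neg_mul, ← ih fun B ↦ k (insert e B), ← Finset.sum_neg_distrib]
    refine Finset.sum_congr rfl fun A hA ↦ ?_
    rw [Finset.sum_powerset_insert fun h ↦ he (Finset.mem_powerset.1 hA h)]
    ring

theorem Finset.forall_eq_zero_iff_alternating (E : Finset α) (D : Finset α → ℤ) :
    (∀ R ⊆ E, D R = 0) ↔ ∀ R ⊆ E, ∑ A ∈ R.powerset, (-1) ^ A.card * D A = 0 := by
  classical
  constructor
  · intro h R hR
    refine Finset.sum_eq_zero fun A hA ↦ ?_
    rw [h A ((Finset.mem_powerset.1 hA).trans hR), mul_zero]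
  · intro h R
    induction R using Finset.strongInduction with
    | H R ih =>
      intro hR
      have h1 := h R hR
      rw [Finset.sum_eq_single R] at h1
      · simpa using h1
      · intro A hA hne
        have hA' := Finset.mem_powerset.1 hA
        rw [ih A (hA'.ssubset_of_ne hne) (hA'.trans hR), mul_zero]
      · simp

theorem Finset.sum_powerset_neg_one_pow_card_sub (B : Finset α) (g : Finset α → ℤ) :
    ∑ A ∈ B.powerset, (-1) ^ (B.card - A.card) * g A =
      (-1) ^ B.card * ∑ A ∈ B.powerset, (-1) ^ A.card * g A := by
  rw [Finset.mul_sum]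
  refine Finset.sum_congr rfl fun A hA ↦ ?_
  have hle := Finset.card_le_card (Finset.mem_powerset.1 hA)
  obtain ⟨d, hd⟩ := Nat.exists_eq_add_of_le hle
  rw [hd, Nat.add_sub_cancel_left, pow_add, ← mul_assoc, mul_right_comm ((-1 : ℤ) ^ A.card),
    ← mul_pow]
  simp

end AlternatingSums

/-! ### The bilinear pair sum and its behaviour under complementation. -/

section Pairs

variable {α : Type*}

/-- The sum of `(-1)^(|B| - |A|) f(A) g(B)` over all `A ⊆ B ⊆ E`. -/
def Finset.alternatingPairSum (E : Finset α) (f g : Finset α → ℤ) : ℤ :=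
  ∑ B ∈ E.powerset, ∑ A ∈ B.powerset, (-1) ^ (B.card - A.card) * f A * g B

theorem Finset.alternatingPairSum_add_left (E : Finset α) (f f' g : Finset α → ℤ) :
    E.alternatingPairSum (fun A ↦ f A + f' A) g =
      E.alternatingPairSum f g + E.alternatingPairSum f' g := by
  simp only [Finset.alternatingPairSum, ← Finset.sum_add_distrib]
  exact Finset.sum_congr rfl fun B _ ↦ Finset.sum_congr rfl fun A _ ↦ by ring

theorem Finset.alternatingPairSum_add_right (E : Finset α) (f g g' : Finset α → ℤ) :
    E.alternatingPairSum f (fun A ↦ g A + g' A) =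
      E.alternatingPairSum f g + E.alternatingPairSum f g' := by
  simp only [Finset.alternatingPairSum, ← Finset.sum_add_distrib]
  exact Finset.sum_congr rfl fun B _ ↦ Finset.sum_congr rfl fun A _ ↦ by ring

theorem Finset.alternatingPairSum_neg_neg (E : Finset α) (f g : Finset α → ℤ) :
    E.alternatingPairSum (fun A ↦ - f A) (fun A ↦ - g A) = E.alternatingPairSum f g := by
  simp only [Finset.alternatingPairSum]
  exact Finset.sum_congr rfl fun B _ ↦ Finset.sum_congr rfl fun A _ ↦ by ring

theorem Finset.alternatingPairSum_eq (E : Finset α) (f g : Finset α → ℤ) :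
    E.alternatingPairSum f g =
      ∑ B ∈ E.powerset, (-1) ^ B.card * (∑ A ∈ B.powerset, (-1) ^ A.card * f A) * g B := by
  refine Finset.sum_congr rfl fun B _ ↦ ?_
  rw [← Finset.sum_powerset_neg_one_pow_card_sub, Finset.sum_mul]

theorem Finset.alternatingPairSum_const_left (E : Finset α) (a : ℤ) (g : Finset α → ℤ) :
    E.alternatingPairSum (fun _ ↦ a) g = a * g ∅ := by
  classical
  rw [Finset.alternatingPairSum_eq, Finset.sum_eq_single ∅]
  · simp
  · intro B _ hB
    rw [← Finset.sum_mul, Finset.sum_powerset_neg_one_pow_card_of_nonempty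
      (Finset.nonempty_iff_ne_empty.2 hB)]
    ring
  · simp

/-- Complementation sends `A ⊆ B` to `E \ B ⊆ E \ A` and keeps `|B| - |A|`, so the two functions
trade places. -/
theorem Finset.alternatingPairSum_compl [DecidableEq α] (E : Finset α) (f g : Finset α → ℤ) :
    E.alternatingPairSum (fun A ↦ f (E \ A)) (fun B ↦ g (E \ B)) =
      E.alternatingPairSum g f := by
  simp only [Finset.alternatingPairSum]
  rw [Finset.sum_sigma', Finset.sum_sigma']
  refine Finset.sum_bij' (fun p _ ↦ ⟨E \ p.2, E \ p.1⟩) (fun p _ ↦ ⟨E \ p.2, E \ p.1⟩) ?_ ?_ ?_ ?_ ?_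
  · rintro ⟨B, A⟩ h
    simp only [Finset.mem_sigma, Finset.mem_powerset] at h ⊢
    exact ⟨Finset.sdiff_subset, Finset.sdiff_subset_sdiff subset_rfl h.2⟩
  · rintro ⟨B, A⟩ h
    simp only [Finset.mem_sigma, Finset.mem_powerset] at h ⊢
    exact ⟨Finset.sdiff_subset, Finset.sdiff_subset_sdiff subset_rfl h.2⟩
  · rintro ⟨B, A⟩ h
    simp only [Finset.mem_sigma, Finset.mem_powerset] at h
    simp [Finset.sdiff_sdiff_eq_self h.1, Finset.sdiff_sdiff_eq_self (h.2.trans h.1)]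
  · rintro ⟨B, A⟩ h
    simp only [Finset.mem_sigma, Finset.mem_powerset] at h
    simp [Finset.sdiff_sdiff_eq_self h.1, Finset.sdiff_sdiff_eq_self (h.2.trans h.1)]
  · rintro ⟨B, A⟩ h
    simp only [Finset.mem_sigma, Finset.mem_powerset] at h
    have h1 := Finset.card_sdiff_add_card_eq_card h.1
    have h2 := Finset.card_sdiff_add_card_eq_card (h.2.trans h.1)
    have h3 := Finset.card_le_card h.2
    have : (E \ A).card - (E \ B).card = B.card - A.card := by omega
    simp only [this]
    ring

theorem Finset.alternatingPairSum_const_right (E : Finset α) (a : ℤ) (f : Finset α → ℤ) :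
    E.alternatingPairSum f (fun _ ↦ a) = a * f E := by
  classical
  have h := E.alternatingPairSum_compl (fun _ ↦ a) fun B ↦ f B
  rw [← h, Finset.alternatingPairSum_const_left, Finset.sdiff_empty]

end Pairs

namespace Matroid

/-! ### Direct sums, circuits and connected parts. -/

section Components

variable {α : Type*} {M : Matroid α}

theorem coe_elements (M : Matroid α) [M.Finite] : (M.elements : Set α) = M.E := by
  simp [Matroid.elements]

theorem elements_restrict (M : Matroid α) (R : Finset α) : (M.restrict (R : Set α)).elements = R := by
  ext x
  simp [Matroid.elements]

/-- The circuits of a direct sum are contained in single summands. -/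
theorem isDirectSumOfNonempty_iff {k : ℕ} : M.IsDirectSumOfNonempty k ↔
    ∃ f : α → ℕ, f '' M.E = Set.Iio k ∧ ∀ C, M.IsCircuit C → ∀ x ∈ C, ∀ y ∈ C, f x = f y := by
  classical
  constructor
  · rintro ⟨N, h, hne, rfl⟩
    have huniq : ∀ i j e, e ∈ (N i).E → e ∈ (N j).E → i = j := fun i j e hi hj ↦ by
      by_contra hij
      exact Set.disjoint_left.1 (h hij) hi hj
    let f : α → ℕ := fun e ↦ if h : ∃ i, e ∈ (N i).E then (h.choose : ℕ) else 0
    have hf : ∀ i e, e ∈ (N i).E → f e = i := fun i e he ↦ by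
      have hex : ∃ i, e ∈ (N i).E := ⟨i, he⟩
      simp only [f, dif_pos hex]
      rw [huniq _ _ e hex.choose_spec he]
    refine ⟨f, ?_, ?_⟩
    · ext n
      simp only [Matroid.disjointSigma_ground_eq, Set.mem_image, Set.mem_iUnion, Set.mem_Iio]
      constructor
      · rintro ⟨e, ⟨i, hi⟩, rfl⟩
        rw [hf i e hi]
        exact i.2
      · intro hn
        obtain ⟨e, he⟩ := (hne ⟨n, hn⟩).ground_nonempty
        exact ⟨e, ⟨⟨n, hn⟩, he⟩, hf ⟨n, hn⟩ e he⟩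
    · intro C hC
      have hCE := hC.subset_ground
      rw [Matroid.disjointSigma_ground_eq] at hCE
      have hdep := hC.not_indep
      rw [Matroid.disjointSigma_indep_iff] at hdep
      have hex : ∃ i, ¬ (N i).Indep (C ∩ (N i).E) := by
        by_contra! hcon
        exact hdep ⟨hcon, hCE⟩
      obtain ⟨i, hi⟩ := hex
      -- A circuit is minimally dependent, so its dependent part in one summand is all of it.
      have hCi : C ∩ (N i).E = C := by
        by_contra hne'
        have hss : C ∩ (N i).E ⊂ C := Set.inter_subset_left.ssubset_of_ne hne'
        have := hC.ssubset_indep hss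
        rw [Matroid.disjointSigma_indep_iff] at this
        have h2 := this.1 i
        rw [Set.inter_assoc, Set.inter_self] at h2
        exact hi h2
      have hsub := Set.inter_eq_left.1 hCi
      intro x hx y hy
      rw [hf i x (hsub hx), hf i y (hsub hy)]
  · rintro ⟨f, hfE, hf⟩
    have hd : Pairwise (Disjoint on
        fun i : Fin k ↦ (M.restrict (M.E ∩ f ⁻¹' {(i : ℕ)})).E) := by
      intro i j hij
      rw [Function.onFun, Set.disjoint_left]
      rintro x ⟨_, hx⟩ ⟨_, hy⟩
      exact hij (Fin.ext (hx.symm.trans hy))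
    refine ⟨fun i ↦ M.restrict (M.E ∩ f ⁻¹' {(i : ℕ)}), hd, ?_, ?_⟩
    · intro i
      have : (i : ℕ) ∈ f '' M.E := hfE ▸ i.2
      obtain ⟨e, he, hei⟩ := this
      exact ⟨⟨e, he, hei⟩⟩
    · refine Matroid.ext_indep ?_ fun I hI ↦ ?_
      · rw [Matroid.disjointSigma_ground_eq]
        ext e
        simp only [Matroid.restrict_ground_eq, Set.mem_iUnion, Set.mem_inter_iff,
          Set.mem_preimage, Set.mem_singleton_iff, exists_and_left, iff_self_and]
        intro he
        have : f e ∈ Set.Iio k := hfE ▸ ⟨e, he, rfl⟩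
        exact ⟨⟨f e, this⟩, rfl⟩
      · rw [Matroid.disjointSigma_indep_iff]
        have hIE : ∀ e ∈ I, ∃ i : Fin k, f e = i := fun e he ↦
          ⟨⟨f e, (hfE ▸ ⟨e, hI he, rfl⟩ : f e ∈ Set.Iio k)⟩, rfl⟩
        constructor
        · intro hI'
          refine ⟨fun i ↦ ?_, fun e he ↦ ?_⟩
          · exact Matroid.restrict_indep_iff.2
              ⟨hI'.subset Set.inter_subset_left, Set.inter_subset_right⟩
          · obtain ⟨i, hi⟩ := hIE e he
            exact Set.mem_iUnion.2 ⟨i, hI he, hi⟩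
        · rintro ⟨hI', -⟩
          by_contra hdep
          obtain ⟨C, hCI, hC⟩ := ((Matroid.not_indep_iff hI).1 hdep).exists_isCircuit_subset
          obtain ⟨x, hx⟩ := hC.nonempty
          obtain ⟨i, hi⟩ := hIE x (hCI hx)
          refine hC.not_indep ((Matroid.restrict_indep_iff.1 (hI' i)).1.subset fun y hy ↦ ?_)
          exact ⟨hCI hy, hI (hCI hy), by
            rw [Set.mem_preimage, Set.mem_singleton_iff, hf C hC y hy x hx, hi]⟩

/-- Bases of a direct sum are the unions of bases of the summands, so complements of bases can be
taken summand by summand. -/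
theorem IsDirectSumOfNonempty.dual {k : ℕ} (h : M.IsDirectSumOfNonempty k) :
    M.dual.IsDirectSumOfNonempty k := by
  obtain ⟨N, h, hne, rfl⟩ := h
  have hd : Pairwise (Disjoint on fun i ↦ ((N i).dual).E) := h
  refine ⟨fun i ↦ (N i).dual, hd, fun i ↦ ⟨(hne i).ground_nonempty⟩, ?_⟩
  refine Matroid.ext_isBase ?_ fun B hB ↦ ?_
  · rw [Matroid.dual_ground, Matroid.disjointSigma_ground_eq, Matroid.disjointSigma_ground_eq]
    simp only [Matroid.dual_ground]
  · have hB' : B ⊆ ⋃ i, (N i).E := by simpa using hB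
    have key : ∀ i, ((⋃ i, (N i).E) \ B) ∩ (N i).E = (N i).E \ (B ∩ (N i).E) := fun i ↦ by
      ext x
      simp only [Set.mem_inter_iff, Set.mem_sdiff, Set.mem_iUnion]
      grind
    rw [Matroid.dual_isBase_iff (by simpa using hB'), Matroid.disjointSigma_isBase_iff,
      Matroid.disjointSigma_isBase_iff]
    simp only [Matroid.disjointSigma_ground_eq, Matroid.dual_ground, key]
    simp only [Matroid.dual_isBase_iff Set.inter_subset_right, hB', and_true, Set.sdiff_subset]

theorem numComponents_dual (M : Matroid α) : M.dual.numComponents = M.numComponents := by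
  unfold Matroid.numComponents
  congr 1
  ext k
  exact ⟨fun h ↦ by simpa using h.dual, fun h ↦ h.dual⟩

/-- `M` restricted to the non-empty set `P` is connected: for every proper non-empty subset `X` of
`P`, some circuit contained in `P` meets both `X` and its complement. -/
def ConnectedOn (M : Matroid α) (P : Set α) : Prop :=
  P.Nonempty ∧ ∀ X ⊆ P, X.Nonempty →
    (∀ C ⊆ P, M.IsCircuit C → (C ∩ X).Nonempty → C ⊆ X) → X = P

/-- A finite matroid is partitioned into `c(M)` connected parts. -/
theorem exists_connectedOn_partition (M : Matroid α) [M.Finite] :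
    ∃ f : α → ℕ, f '' M.E = Set.Iio M.numComponents ∧
      (∀ C, M.IsCircuit C → ∀ x ∈ C, ∀ y ∈ C, f x = f y) ∧
      ∀ i < M.numComponents, M.ConnectedOn (M.E ∩ f ⁻¹' {i}) := by
  classical
  have hg := M.isGreatest_numComponents
  obtain ⟨f, hfE, hf⟩ := isDirectSumOfNonempty_iff.1 hg.1
  refine ⟨f, hfE, hf, fun i hi ↦ ?_⟩
  have hi' : i ∈ f '' M.E := hfE ▸ hi
  refine ⟨let ⟨e, he, hei⟩ := hi'; ⟨e, he, hei⟩, fun X hXP ⟨x, hx⟩ hX ↦ ?_⟩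
  by_contra hne
  obtain ⟨y, hyP, hyX⟩ := Set.exists_of_ssubset (hXP.ssubset_of_ne hne)
  -- Were part `i` not connected, giving `X` the fresh label `c(M)` would split it off, against
  -- maximality; `y` keeps the label `i` in use.
  have : M.IsDirectSumOfNonempty (M.numComponents + 1) := by
    refine isDirectSumOfNonempty_iff.2 ⟨fun e ↦ if e ∈ X then M.numComponents else f e, ?_, ?_⟩
    · ext n
      simp only [Set.mem_image, Set.mem_Iio]
      constructor
      · rintro ⟨e, he, rfl⟩
        split_ifs
        · omega
        · have : f e ∈ Set.Iio M.numComponents := hfE ▸ ⟨e, he, rfl⟩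
          have := Set.mem_Iio.1 this
          omega
      · intro hn
        rcases Nat.lt_succ_iff_lt_or_eq.1 hn with hn | rfl
        · by_cases hni : n = i
          · subst hni
            exact ⟨y, hyP.1, by rw [if_neg hyX]; exact hyP.2⟩
          · obtain ⟨e, he, hen⟩ : n ∈ f '' M.E := hfE ▸ hn
            refine ⟨e, he, ?_⟩
            rw [if_neg, hen]
            intro heX
            exact hni (hen.symm.trans (hXP heX).2)
        · exact ⟨x, (hXP hx).1, if_pos hx⟩
    · intro C hC a ha b hb
      have key : ∀ a ∈ C, ∀ b ∈ C, a ∈ X → b ∈ X := by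
        intro a ha b hb haX
        refine hX C (fun z hz ↦ ⟨hC.subset_ground hz, ?_⟩) hC ⟨a, ha, haX⟩ hb
        exact (hf C hC z hz a ha).trans (hXP haX).2
      by_cases haX : a ∈ X
      · simp [haX, key a ha b hb haX]
      · have : b ∉ X := fun h ↦ haX (key b hb a ha h)
        simp [haX, this, hf C hC a ha b hb]
  have := hg.2 this
  omega

theorem numComponents_of_ground_eq_empty [M.Finite] (h : M.E = ∅) : M.numComponents = 0 := by
  obtain ⟨f, hfE, -⟩ := M.exists_connectedOn_partition
  rw [h, Set.image_empty] at hfE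
  by_contra hne
  exact (hfE ▸ Set.notMem_empty 0 : (0 : ℕ) ∉ Set.Iio M.numComponents) (Nat.pos_of_ne_zero hne)

theorem numComponents_of_ground_eq_singleton [M.Finite] {e : α} (h : M.E = {e}) :
    M.numComponents = 1 := by
  obtain ⟨f, hfE, -⟩ := M.exists_connectedOn_partition
  rw [h, Set.image_singleton] at hfE
  have := congrArg Set.ncard hfE
  simpa [Set.ncard_Iio_nat] using this.symm

end Components

/-! ### Rank as a natural number, duality and additivity. -/

section Rank

variable {α : Type*} {M : Matroid α}

theorem eRk_coe_finset_ne_top (M : Matroid α) (A : Finset α) : M.eRk (A : Set α) ≠ ⊤ :=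
  ((M.eRk_le_encard _).trans_lt A.finite_toSet.encard_lt_top).ne

theorem coe_rkNat (M : Matroid α) (A : Finset α) :
    ((M.rkNat (A : Set α) : ℕ) : ℕ∞) = M.eRk (A : Set α) :=
  ENat.natCast_toNat (M.eRk_coe_finset_ne_top A)

theorem rkNat_empty (M : Matroid α) : M.rkNat ∅ = 0 := by
  simp [Matroid.rkNat]

theorem rkNat_restrict (M : Matroid α) {R A : Set α} (h : A ⊆ R) :
    (M.restrict R).rkNat A = M.rkNat A := by
  rw [Matroid.rkNat, Matroid.restrict_eRk_eq M h, Matroid.rkNat]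

theorem rkNat_singleton_le (M : Matroid α) (e : α) : M.rkNat {e} ≤ 1 := by
  rw [Matroid.rkNat]
  exact ENat.toNat_le_of_le_natCast (M.eRk_singleton_le e)

theorem rkNat_dual_add (M : Matroid α) [M.Finite] [DecidableEq α] {A : Finset α}
    (hA : A ⊆ M.elements) :
    M.dual.rkNat (A : Set α) + M.rkNat M.E = M.rkNat ((M.elements \ A : Finset α) : Set α) + A.card := by
  have hAE : (A : Set α) ⊆ M.E := by
    rw [← M.coe_elements]
    exact_mod_cast hA
  have h := M.eRk_dual_add_eRank (A : Set α) hAE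
  have hE : ((M.rkNat M.E : ℕ) : ℕ∞) = M.eRank := by
    rw [← M.coe_elements, coe_rkNat, M.coe_elements, Matroid.eRk_ground]
  rw [← coe_rkNat, ← hE, ← M.coe_elements, ← Finset.coe_sdiff, ← coe_rkNat,
    Set.encard_coe_eq_coe_finsetCard] at h
  rw [← M.coe_elements]
  exact_mod_cast h

/-- The rank is additive over a partition which no circuit crosses. -/
theorem rkNat_eq_sum (M : Matroid α) {A : Finset α} (hA : (A : Set α) ⊆ M.E) (f : α → ℕ) (k : ℕ)
    (hk : ∀ e ∈ A, f e < k)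
    (hf : ∀ C ⊆ (A : Set α), M.IsCircuit C → ∀ x ∈ C, ∀ y ∈ C, f x = f y) :
    M.rkNat (A : Set α) = ∑ i ∈ Finset.range k, M.rkNat (A.filter (f · = i) : Finset α) := by
  classical
  obtain ⟨I, hI⟩ := M.exists_isBasis (A : Set α) hA
  have hIfin : I.Finite := A.finite_toSet.subset hI.subset
  obtain ⟨I, rfl⟩ := hIfin.exists_finset_coe
  have hIA : I ⊆ A := by exact_mod_cast hI.subset
  have hrk : ∀ {J B : Finset α}, M.IsBasis (J : Set α) (B : Set α) →
      M.rkNat (B : Set α) = J.card := fun {J B} h ↦ by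
    rw [Matroid.rkNat, h.eRk_eq_encard, Set.encard_coe_eq_coe_finsetCard, ENat.toNat_natCast]
  rw [hrk hI, Finset.card_eq_sum_card_fiberwise (f := f) (t := Finset.range k)
    fun e he ↦ by simpa using hk e (hIA he)]
  refine Finset.sum_congr rfl fun i _ ↦ (hrk ?_).symm
  have hsub : I.filter (f · = i) ⊆ A.filter (f · = i) := Finset.filter_subset_filter _ hIA
  have hAi : ((A.filter (f · = i) : Finset α) : Set α) ⊆ M.E :=
    (by exact_mod_cast Finset.filter_subset _ _ : ((A.filter (f · = i) : Finset α) : Set α) ⊆ A).trans hA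
  have hind : M.Indep ((I.filter (f · = i) : Finset α) : Set α) :=
    hI.indep.subset (by exact_mod_cast Finset.filter_subset _ _)
  refine hind.isBasis_of_subset_of_subset_closure (by exact_mod_cast hsub) fun e he ↦ ?_
  have he' := Finset.mem_filter.1 (Finset.mem_coe.1 he)
  by_cases heI : e ∈ I
  · exact M.mem_closure_of_mem (by simp [heI, he'.2]) (by
      exact_mod_cast (show _ from hind.subset_ground))
  · have hecl : e ∈ M.closure (I : Set α) := hI.subset_closure he'.1
    -- This circuit lies in `I ∪ {e}` and carries the single label of `e`, so it already witnesses
    -- that the part of `I` with that label spans `e`.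
    obtain ⟨C, hCI, hC, heC⟩ := Matroid.exists_isCircuit_of_mem_closure hecl (by simpa using heI)
    have hCA : C ⊆ A := hCI.trans (Set.insert_subset he'.1 hI.subset)
    rw [Matroid.mem_closure_iff_exists_isCircuit (by simp [heI])]
    refine ⟨C, fun x hx ↦ ?_, hC, heC⟩
    have hxe := (hf C hCA hC x hx e heC).trans he'.2
    rcases hCI hx with h | h
    · exact Or.inl h
    · exact Or.inr (by simpa using ⟨h, hxe⟩)

end Rank

/-! ### Duality of (1), and the equivalence of (1) and (2). -/

section Identities

variable {α : Type*} {M : Matroid α}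

theorem componentIdentity_iff (M : Matroid α) [M.Finite] : M.ComponentIdentity ↔
    (M.numComponents : ℤ) = M.elements.card -
      M.elements.alternatingPairSum M.corank (fun B ↦ (M.rkNat (B : Set α) : ℤ)) :=
  Iff.rfl

theorem ComponentIdentity.dual [M.Finite] (h : M.ComponentIdentity) : M.dual.ComponentIdentity := by
  classical
  have hel : M.dual.elements = M.elements := by
    ext x
    simp [Matroid.elements]
  rw [componentIdentity_iff] at h ⊢
  rw [numComponents_dual, hel, h]
  congr 1
  set E := M.elements
  set r : ℤ := (M.rkNat M.E : ℤ)
  have hrE : ((M.rkNat (E : Set α) : ℕ) : ℤ) = r := by rw [M.coe_elements]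
  have hcl : ∀ A ⊆ E, M.dual.corank A = r + -(M.rkNat ((E \ A : Finset α) : Set α) : ℤ) := by
    intro A hA
    have := M.rkNat_dual_add hA
    simp only [Matroid.corank]
    rw [Finset.coe_sdiff] at this ⊢
    simp only [r, E]
    omega
  have hrk : ∀ A ⊆ E, (M.dual.rkNat (A : Set α) : ℤ) = M.corank E + -M.corank (E \ A) := by
    intro A hA
    have := M.rkNat_dual_add hA
    have hc := Finset.card_sdiff_add_card_eq_card hA
    simp only [Matroid.corank, hrE]
    simp only [r, E] at *
    omega
  have hS : E.alternatingPairSum M.dual.corank (fun B ↦ (M.dual.rkNat (B : Set α) : ℤ)) =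
      E.alternatingPairSum (fun A ↦ r + -(M.rkNat ((E \ A : Finset α) : Set α) : ℤ))
        (fun B ↦ M.corank E + -M.corank (E \ B)) := by
    refine Finset.sum_congr rfl fun B hB ↦ Finset.sum_congr rfl fun A hA ↦ ?_
    have hB := Finset.mem_powerset.1 hB
    have hA := Finset.mem_powerset.1 hA
    simp only [hcl A (hA.trans hB), hrk B hB]
  -- After complementing, the constant `ℓ(E)` on the left gives `ℓ(E) r` and the constant `r` on the
  -- right gives `-r ℓ(E)`; these cancel.
  rw [hS, E.alternatingPairSum_compl (fun A ↦ r + -(M.rkNat (A : Set α) : ℤ))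
      (fun B ↦ M.corank E + -M.corank B),
    Finset.alternatingPairSum_add_left, Finset.alternatingPairSum_const_left,
    Finset.alternatingPairSum_add_right, Finset.alternatingPairSum_const_right,
    Finset.alternatingPairSum_neg_neg]
  simp only [Finset.coe_empty, rkNat_empty]
  push_cast
  ring

theorem componentIdentity_dual_iff (M : Matroid α) [M.Finite] :
    M.ComponentIdentity ↔ M.dual.ComponentIdentity :=
  ⟨fun h ↦ h.dual, fun h ↦ by
    have h2 := h.dual
    rw [componentIdentity_iff] at h2 ⊢
    simpa [Matroid.elements] using h2⟩

theorem betaRankIdentity_restrict_iff (M : Matroid α) (R : Finset α) :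
    (M.restrict (R : Set α)).BetaRankIdentity ↔
      (∑ A ∈ R.powerset, (-1) ^ A.card * (M.rkNat (A : Set α) : ℤ)) * (M.rkNat (R : Set α) : ℤ) =
        ∑ A ∈ R.powerset, (-1) ^ A.card * ((M.restrict (A : Set α)).numComponents : ℤ) := by
  have h1 : ∑ A ∈ R.powerset, (-1) ^ A.card * ((M.restrict (R : Set α)).rkNat (A : Set α) : ℤ) =
      ∑ A ∈ R.powerset, (-1) ^ A.card * (M.rkNat (A : Set α) : ℤ) :=
    Finset.sum_congr rfl fun A hA ↦ by
      rw [M.rkNat_restrict (by exact_mod_cast Finset.mem_powerset.1 hA)]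
  have h2 : ∑ A ∈ R.powerset, (-1) ^ A.card *
        ((((M.restrict (R : Set α)).restrict (A : Set α)).numComponents : ℕ) : ℤ) =
      ∑ A ∈ R.powerset, (-1) ^ A.card * ((M.restrict (A : Set α)).numComponents : ℤ) :=
    Finset.sum_congr rfl fun A hA ↦ by
      rw [M.restrict_restrict_eq (by exact_mod_cast Finset.mem_powerset.1 hA)]
  rw [Matroid.BetaRankIdentity, Matroid.crapoBeta, elements_restrict, h1, h2,
    Matroid.restrict_ground_eq, M.rkNat_restrict subset_rfl, mul_assoc]
  exact mul_right_inj' (pow_ne_zero _ (by norm_num))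

theorem componentIdentity_restrict_iff (M : Matroid α) (R : Finset α) :
    (M.restrict (R : Set α)).ComponentIdentity ↔
      ((M.restrict (R : Set α)).numComponents : ℤ) - R.card +
        ∑ B ∈ R.powerset, ∑ A ∈ B.powerset,
          (-1) ^ (B.card - A.card) * M.corank A * (M.rkNat (B : Set α) : ℤ) = 0 := by
  rw [componentIdentity_iff, elements_restrict]
  have : R.alternatingPairSum (M.restrict (R : Set α)).corank
      (fun B ↦ ((M.restrict (R : Set α)).rkNat (B : Set α) : ℤ)) =
      R.alternatingPairSum M.corank (fun B ↦ (M.rkNat (B : Set α) : ℤ)) := by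
    refine Finset.sum_congr rfl fun B hB ↦ Finset.sum_congr rfl fun A hA ↦ ?_
    have hB := Finset.mem_powerset.1 hB
    have hA := Finset.mem_powerset.1 hA
    simp only [Matroid.corank]
    rw [M.rkNat_restrict (by exact_mod_cast hA.trans hB), M.rkNat_restrict (by exact_mod_cast hB)]
  rw [this, Finset.alternatingPairSum]
  constructor <;> intro h <;> linarith

/-- The component identity holds for all restrictions if and only if the identity for Crapo's
invariant holds for all restrictions to at least two elements. -/
theorem forall_componentIdentity_iff (M : Matroid α) (E : Finset α) :
    (∀ R : Finset α, R ⊆ E → (M.restrict (R : Set α)).ComponentIdentity) ↔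
      (∀ R : Finset α, R ⊆ E → 2 ≤ R.card → (M.restrict (R : Set α)).BetaRankIdentity) := by
  classical
  set k : Finset α → ℤ := fun B ↦ ∑ A ∈ B.powerset,
    (-1) ^ (B.card - A.card) * M.corank A * (M.rkNat (B : Set α) : ℤ) with hk
  -- `D R` is the defect of (1) for the restriction to `R`.
  set D : Finset α → ℤ := fun R ↦
    ((M.restrict (R : Set α)).numComponents : ℤ) - R.card + ∑ B ∈ R.powerset, k B with hD
  have hk' : ∀ B, k B = (-1) ^ B.card *
      (∑ A ∈ B.powerset, (-1) ^ A.card * M.corank A) * (M.rkNat (B : Set α) : ℤ) := fun B ↦ by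
    simp only [hk]
    rw [← Finset.sum_mul, Finset.sum_powerset_neg_one_pow_card_sub]
  have hk0 : k ∅ = 0 := by simp [hk', rkNat_empty]
  have hk1 : ∀ e, k {e} = 0 := fun e ↦ by
    rw [hk', ← insert_empty_eq, Finset.sum_powerset_alternating_insert (Finset.notMem_empty e)]
    have h1 := M.rkNat_singleton_le e
    have : M.rkNat {e} = 0 ∨ M.rkNat {e} = 1 := by omega
    rcases this with h | h <;> simp [Matroid.corank, rkNat_empty, h]
  have hD0 : D ∅ = 0 := by
    have : (M.restrict ((∅ : Finset α) : Set α)).numComponents = 0 :=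
      numComponents_of_ground_eq_empty (by simp)
    simp only [hD, this]
    simp [hk0]
  have hD1 : ∀ e, D {e} = 0 := fun e ↦ by
    have : (M.restrict (({e} : Finset α) : Set α)).numComponents = 1 :=
      numComponents_of_ground_eq_singleton (e := e) (by simp)
    simp only [hD, this]
    rw [← insert_empty_eq, Finset.sum_powerset_insert (Finset.notMem_empty e)]
    simp [hk0, hk1]
  have hDs : ∀ R : Finset α, R.card < 2 → D R = 0 := fun R hR ↦ by
    rcases Finset.eq_empty_or_nonempty R with rfl | hne
    · exact hD0
    · obtain ⟨e, rfl⟩ := Finset.card_eq_one.1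
        (by have := hne.card_pos; omega : R.card = 1)
      exact hD1 e
  have halt : ∀ R : Finset α, 2 ≤ R.card → (∑ A ∈ R.powerset, (-1) ^ A.card * D A = 0 ↔
      (M.restrict (R : Set α)).BetaRankIdentity) := fun R hR ↦ by
    rw [betaRankIdentity_restrict_iff]
    have h1 : ∑ A ∈ R.powerset, (-1) ^ A.card * D A =
        ∑ A ∈ R.powerset, (-1) ^ A.card * ((M.restrict (A : Set α)).numComponents : ℤ) -
        ∑ A ∈ R.powerset, (-1) ^ A.card * (A.card : ℤ) +
        ∑ A ∈ R.powerset, (-1) ^ A.card * ∑ B ∈ A.powerset, k B := by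
      rw [← Finset.sum_sub_distrib, ← Finset.sum_add_distrib]
      exact Finset.sum_congr rfl fun A _ ↦ by simp only [hD]; ring
    have h2 : ∑ A ∈ R.powerset, (-1) ^ A.card * M.corank A =
        - ∑ A ∈ R.powerset, (-1) ^ A.card * (M.rkNat (A : Set α) : ℤ) := by
      rw [eq_neg_iff_add_eq_zero, ← Finset.sum_powerset_alternating_card hR,
        ← Finset.sum_add_distrib]
      exact Finset.sum_congr rfl fun A _ ↦ by simp only [Matroid.corank]; ring
    rw [h1, Finset.sum_powerset_alternating_card hR, Finset.sum_powerset_alternating_sum_powerset,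
      hk', h2, ← mul_assoc, ← mul_assoc, ← mul_pow]
    simp only [neg_mul_neg, one_mul, one_pow]
    constructor <;> intro h <;> linarith
  have : (∀ R : Finset α, R ⊆ E → (M.restrict (R : Set α)).ComponentIdentity) ↔
      ∀ R ⊆ E, D R = 0 :=
    forall₂_congr fun R _ ↦ M.componentIdentity_restrict_iff R
  rw [this, Finset.forall_eq_zero_iff_alternating]
  refine forall₂_congr fun R _ ↦ ?_
  -- For smaller `R` there is nothing to assume: `D` already vanishes on `R` and its subsets.
  by_cases hR : 2 ≤ R.card
  · simp [hR, halt R hR]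
  · simp only [hR, false_imp_iff, iff_true]
    refine Finset.sum_eq_zero fun A hA ↦ ?_
    have := Finset.card_le_card (Finset.mem_powerset.1 hA)
    rw [hDs A (by omega), mul_zero]

end Identities

end Matroid

/-! ### Cycles, paths and the incidence matrix of a multigraph. -/

/-- Starting at `m + 1`, all indices are reached in `n` steps without using the step out of `m`: a
cycle with one edge removed is still a path. -/
theorem Fin.eq_of_forall_ne_eq_add_one {n : ℕ} {β : Type*} {f : Fin (n + 1) → β} {m : Fin (n + 1)}
    (h : ∀ i ≠ m, f i = f (i + 1)) (i j : Fin (n + 1)) : f i = f j := by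
  have key : ∀ t : ℕ, t ≤ n → f (m + 1 + Fin.ofNat (n + 1) t) = f (m + 1) := by
    intro t
    induction t with
    | zero => intro _; congr 1; ext; simp
    | succ t ih =>
      intro ht
      rw [← ih (by omega), h (m + 1 + Fin.ofNat (n + 1) t)]
      · congr 1
        rw [add_assoc (m + 1)]
        congr 1
        ext
        simp [Fin.val_add]
      · intro heq
        have h0 : (1 + Fin.ofNat (n + 1) t : Fin (n + 1)) = 0 := by
          rwa [add_assoc, add_eq_left] at heq
        have := congrArg Fin.val h0
        rw [Fin.val_add] at this
        simp only [Fin.val_one', Fin.val_ofNat, Nat.add_mod_mod, Nat.mod_add_mod, Fin.val_zero] at this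
        rw [Nat.mod_eq_of_lt (by omega)] at this
        omega
  have key' : ∀ i, f i = f (m + 1) := fun i ↦ by
    have := key (i - (m + 1)).val (by omega)
    rwa [show m + 1 + Fin.ofNat (n + 1) (i - (m + 1)).val = i by
      rw [Fin.ofNat_val_eq_self, add_sub_cancel]] at this
  rw [key' i, key' j]

theorem Submodule.finrank_sup_span_singleton_of_notMem {K E : Type*} [DivisionRing K] [AddCommGroup E]
    [Module K E] {p : Submodule K E} [FiniteDimensional K p] {z : E} (hz : z ∉ p) :
    Module.finrank K ↥(p ⊔ Submodule.span K {z}) = Module.finrank K p + 1 := by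
  have hz0 : z ≠ 0 := fun h ↦ hz (h ▸ p.zero_mem)
  have h := Submodule.finrank_sup_add_finrank_inf_eq p (Submodule.span K {z})
  have hd : p ⊓ Submodule.span K {z} = ⊥ :=
    ((Submodule.disjoint_span_singleton' hz0).2 hz).eq_bot
  rw [hd, finrank_bot, add_zero, finrank_span_singleton hz0] at h
  exact h

namespace Graph

variable {V α : Type*} {G : Graph V α}

/-- The simple graph on `V` whose edges are the pairs of vertices joined by an edge in `A`. -/
def joinedBy (G : Graph V α) (A : Set α) : SimpleGraph V where
  Adj x y := x ≠ y ∧ ∃ e ∈ A, G.IsLink e x y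
  symm := ⟨fun _ _ h ↦ ⟨h.1.symm, let ⟨e, he, hl⟩ := h.2; ⟨e, he, hl.symm⟩⟩⟩
  loopless := ⟨fun _ h ↦ h.1 rfl⟩

theorem IsLink.reachable {A : Set α} {e : α} {x y : V} (h : G.IsLink e x y) (he : e ∈ A) :
    (G.joinedBy A).Reachable x y := by
  by_cases hxy : x = y
  · rw [hxy]
  · exact SimpleGraph.Adj.reachable (G := G.joinedBy A) ⟨hxy, e, he, h⟩

theorem isCycleEdgeSet_singleton {e : α} {x : V} (h : G.IsLink e x x) : G.IsCycleEdgeSet {e} :=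
  ⟨0, fun _ ↦ x, fun _ ↦ e, fun i j _ ↦ by omega, fun i j _ ↦ by omega,
    fun _ ↦ h, by simp⟩

/-- An edge whose ends are joined by a path avoiding it lies in a cycle. -/
theorem exists_isCycleEdgeSet_of_reachable {A : Set α} {e : α} {x y : V} (h : G.IsLink e x y)
    (he : e ∉ A) (hr : (G.joinedBy A).Reachable x y) :
    ∃ C ⊆ insert e A, G.IsCycleEdgeSet C ∧ e ∈ C := by
  classical
  obtain ⟨p, hp⟩ := hr.exists_isPath
  have hadj : ∀ i : ℕ, i < p.length → ∃ f ∈ A, G.IsLink f (p.getVert i) (p.getVert (i + 1)) :=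
    fun i hi ↦ (p.adj_getVert_succ hi).2
  have : Nonempty α := ⟨e⟩
  choose! g hgA hg using hadj
  have hval : ∀ i : Fin (p.length + 1), (i : ℕ) < p.length → ((i + 1 : Fin _) : ℕ) = i + 1 :=
    fun i hi ↦ by
      rw [Fin.val_add_one_of_lt]
      simpa [Fin.lt_def] using hi
  -- The path edges take the indices below `p.length`, and `e` closes the cycle at the last index. A
  -- path of length zero yields a loop.
  refine ⟨Set.range fun i : Fin (p.length + 1) ↦ if (i : ℕ) < p.length then g i else e, ?_,
    ⟨p.length, fun i ↦ p.getVert i, _, ?_, ?_, ?_, rfl⟩, ⟨Fin.last _, by simp⟩⟩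
  · rintro _ ⟨i, rfl⟩
    dsimp only
    split_ifs with hi
    · exact Or.inr (hgA i hi)
    · exact Or.inl rfl
  · intro i j hij
    exact Fin.ext (hp.getVert_injOn (Nat.lt_succ_iff.1 i.2) (Nat.lt_succ_iff.1 j.2) hij)
  · intro i j hij
    dsimp only at hij
    have hinj : ∀ a b : ℕ, a ≤ p.length → b ≤ p.length → p.getVert a = p.getVert b → a = b :=
      fun a b ha hb hab ↦ hp.getVert_injOn ha hb hab
    ext
    split_ifs at hij with hi hj hj
    · have h1 := hg i hi
      rw [hij] at h1
      -- Equal edges have equal end pairs. The reversed orientation would force `i = j + 1` and `i +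
      -- 1 = j`.
      rcases h1.eq_and_eq_or_eq_and_eq (hg j hj) with ⟨h2, -⟩ | ⟨h2, h3⟩
      · exact hinj _ _ (by omega) (by omega) h2
      · have := hinj _ _ (by omega) (by omega) h2
        have := hinj _ _ (by omega) (by omega) h3
        omega
    · exact absurd (hij ▸ hgA i hi) he
    · exact absurd (hij ▸ hgA j hj) he
    · omega
  · intro i
    dsimp only
    split_ifs with hi
    · rw [hval i hi]
      exact hg i hi
    · have : i = Fin.last _ := Fin.ext (by simp; omega)
      subst this
      simpa using h.symm

/-- The ends of an edge of a cycle are joined by the remaining edges of the cycle. -/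
theorem IsCycleEdgeSet.reachable {A C : Set α} (hC : G.IsCycleEdgeSet C) {e : α} (heC : e ∈ C)
    (hCA : C ⊆ insert e A) {x y : V} (h : G.IsLink e x y) : (G.joinedBy A).Reachable x y := by
  obtain ⟨n, v, f, hv, hf, hl, rfl⟩ := hC
  obtain ⟨m, rfl⟩ := heC
  have key := Fin.eq_of_forall_ne_eq_add_one
    (f := fun i ↦ (G.joinedBy A).connectedComponentMk (v i)) (m := m) (fun i hi ↦ by
      rw [SimpleGraph.ConnectedComponent.eq]
      exact (hl i).reachable ((hCA ⟨i, rfl⟩).resolve_left fun h ↦ hi (hf h))) m (m + 1)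
  rw [SimpleGraph.ConnectedComponent.eq] at key
  rcases h.eq_and_eq_or_eq_and_eq (hl m) with ⟨rfl, rfl⟩ | ⟨rfl, rfl⟩
  · exact key
  · exact key.symm

/-- The span of the rows of the oriented incidence matrix that belong to `A`. -/
noncomputable def incidenceSpan (G : Graph V α) (A : Set α) : Submodule ℚ (V →₀ ℚ) :=
  Submodule.span ℚ {z | ∃ e ∈ A, ∃ x y, G.IsLink e x y ∧
    z = Finsupp.single x 1 - Finsupp.single y 1}

theorem sub_mem_incidenceSpan_iff {A : Set α} {x y : V} :
    (Finsupp.single x 1 - Finsupp.single y 1 : V →₀ ℚ) ∈ G.incidenceSpan A ↔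
      (G.joinedBy A).Reachable x y := by
  classical
  constructor
  · intro h
    by_contra hxy
    -- Summing the coordinates over the component of `x` kills every generator but is `1` on the
    -- given vector.
    let φ : (V →₀ ℚ) →ₗ[ℚ] ℚ :=
      Finsupp.linearCombination ℚ fun w ↦ if (G.joinedBy A).Reachable x w then (1 : ℚ) else 0
    have hle : G.incidenceSpan A ≤ LinearMap.ker φ := by
      rw [incidenceSpan, Submodule.span_le]
      rintro _ ⟨e, he, a, b, hl, rfl⟩
      have hab := hl.reachable he
      have : (G.joinedBy A).Reachable x a ↔ (G.joinedBy A).Reachable x b :=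
        ⟨fun h ↦ h.trans hab, fun h ↦ h.trans hab.symm⟩
      simp [φ, this]
    have := hle h
    simp [φ, hxy] at this
  · rintro ⟨p⟩
    induction p with
    | nil => simp
    | cons hadj p ih =>
      obtain ⟨-, e, he, hl⟩ := hadj
      have := (G.incidenceSpan A).add_mem (Submodule.subset_span ⟨e, he, _, _, hl, rfl⟩) ih
      simpa using this

theorem incidenceSpan_insert {A : Set α} {e : α} {x y : V} (h : G.IsLink e x y) :
    G.incidenceSpan (insert e A) =
      G.incidenceSpan A ⊔ Submodule.span ℚ {Finsupp.single x 1 - Finsupp.single y 1} := by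
  apply le_antisymm
  · rw [incidenceSpan, Submodule.span_le]
    rintro _ ⟨f, hf, a, b, hl, rfl⟩
    rcases hf with rfl | hf
    · refine Submodule.mem_sup_right ?_
      rcases hl.eq_and_eq_or_eq_and_eq h with ⟨rfl, rfl⟩ | ⟨rfl, rfl⟩
      · exact Submodule.mem_span_singleton_self _
      · have := (Submodule.span ℚ _).neg_mem (Submodule.mem_span_singleton_self (R := ℚ)
          (Finsupp.single b 1 - Finsupp.single a 1 : V →₀ ℚ))
        rwa [neg_sub] at this
    · exact Submodule.mem_sup_left (Submodule.subset_span ⟨f, hf, a, b, hl, rfl⟩)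
  · refine sup_le (Submodule.span_mono ?_) ?_
    · rintro z ⟨f, hf, a, b, hl, rfl⟩
      exact ⟨f, Or.inr hf, a, b, hl, rfl⟩
    · rw [Submodule.span_singleton_le_iff_mem]
      exact Submodule.subset_span ⟨e, Or.inl rfl, x, y, h, rfl⟩

/-- If the edges in `A` connect the vertices in `W`, then the rank of the incidence matrix of `A`
is `|W| - 1`. -/
theorem finrank_incidenceSpan_add_one {A : Set α} {W : Finset V} {w : V} (hw : w ∈ W)
    (hA : ∀ e ∈ A, ∀ x y, G.IsLink e x y → x ∈ W)
    (hW : ∀ x ∈ W, (G.joinedBy A).Reachable w x) [FiniteDimensional ℚ (G.incidenceSpan A)] :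
    Module.finrank ℚ (G.incidenceSpan A) + 1 = W.card := by
  classical
  have hnot : (Finsupp.single w 1 : V →₀ ℚ) ∉ G.incidenceSpan A := by
    intro h
    -- The sum of all coordinates kills the span but not the unit vector at `w`; adjoining that
    -- vector yields all unit vectors of `W`.
    let φ : (V →₀ ℚ) →ₗ[ℚ] ℚ := Finsupp.linearCombination ℚ fun _ ↦ (1 : ℚ)
    have hle : G.incidenceSpan A ≤ LinearMap.ker φ := by
      rw [incidenceSpan, Submodule.span_le]
      rintro _ ⟨e, he, a, b, hl, rfl⟩
      simp [φ]
    have := hle h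
    simp [φ] at this
  rw [← Submodule.finrank_sup_span_singleton_of_notMem hnot]
  have heq : G.incidenceSpan A ⊔ Submodule.span ℚ {Finsupp.single w 1} =
      Submodule.span ℚ (Set.range fun x : W ↦ (Finsupp.single (x : V) 1 : V →₀ ℚ)) := by
    apply le_antisymm
    · refine sup_le ?_ ?_
      · rw [incidenceSpan, Submodule.span_le]
        rintro _ ⟨e, he, a, b, hl, rfl⟩
        exact Submodule.sub_mem _ (Submodule.subset_span ⟨⟨a, hA e he a b hl⟩, rfl⟩)
          (Submodule.subset_span ⟨⟨b, hA e he b a hl.symm⟩, rfl⟩)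
      · rw [Submodule.span_singleton_le_iff_mem]
        exact Submodule.subset_span ⟨⟨w, hw⟩, rfl⟩
    · rw [Submodule.span_le]
      rintro _ ⟨⟨x, hx⟩, rfl⟩
      have h1 := sub_mem_incidenceSpan_iff.2 (hW x hx)
      have h2 := Submodule.sub_mem (G.incidenceSpan A ⊔ Submodule.span ℚ {Finsupp.single w 1})
        (Submodule.mem_sup_right (Submodule.mem_span_singleton_self _))
        (Submodule.mem_sup_left h1)
      simpa using h2
  have hli : LinearIndependent ℚ fun x : W ↦ (Finsupp.single (x : V) 1 : V →₀ ℚ) :=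
    (Finsupp.linearIndependent_single_one ℚ V).comp _ Subtype.val_injective
  rw [heq, finrank_span_eq_card hli, Fintype.card_coe]

end Graph

/-! ### Ranks of connected edge sets in cycle matroids. -/

namespace Matroid.IsCycleMatroidOf

variable {V α : Type*} {G : Graph V α} {M : Matroid α}

theorem mem_closure_iff (h : M.IsCycleMatroidOf G) {A : Set α} (hA : A ⊆ M.E) {e : α} {x y : V}
    (he : G.IsLink e x y) : e ∈ M.closure A ↔ (G.joinedBy A).Reachable x y := by
  by_cases heA : e ∈ A
  · exact ⟨fun _ ↦ he.reachable heA, fun _ ↦ M.mem_closure_of_mem heA hA⟩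
  · rw [Matroid.mem_closure_iff_exists_isCircuit heA]
    constructor
    · rintro ⟨C, hCA, hC, heC⟩
      exact ((h.2 C).1 hC).reachable heC hCA he
    · intro hr
      obtain ⟨C, hCA, hC, heC⟩ := Graph.exists_isCycleEdgeSet_of_reachable he heA hr
      exact ⟨C, hCA, (h.2 C).2 hC, heC⟩

theorem exists_isLink (h : M.IsCycleMatroidOf G) {e : α} (he : e ∈ M.E) : ∃ x y, G.IsLink e x y :=
  (G.edge_mem_iff_exists_isLink e).1 (h.1 ▸ he)

/-- Add edges one at a time: both sides stay put when the ends are already joined, and grow by one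
otherwise. -/
theorem rkNat_eq_finrank (h : M.IsCycleMatroidOf G) (A : Finset α) (hA : (A : Set α) ⊆ M.E) :
    FiniteDimensional ℚ (G.incidenceSpan (A : Set α)) ∧
      M.rkNat (A : Set α) = Module.finrank ℚ (G.incidenceSpan (A : Set α)) := by
  classical
  induction A using Finset.induction_on with
  | empty =>
    have : G.incidenceSpan ((∅ : Finset α) : Set α) = ⊥ := by simp [Graph.incidenceSpan]
    rw [this]
    exact ⟨inferInstance, by simp [Matroid.rkNat]⟩
  | insert e A heA ih =>
    rw [Finset.coe_insert] at hA ⊢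
    obtain ⟨heE, hAE⟩ := Set.insert_subset_iff.1 hA
    obtain ⟨hfin, hrk⟩ := ih hAE
    obtain ⟨x, y, hl⟩ := h.exists_isLink heE
    rw [Graph.incidenceSpan_insert hl]
    refine ⟨inferInstance, ?_⟩
    by_cases hr : (G.joinedBy (A : Set α)).Reachable x y
    · have hcl := (h.mem_closure_iff hAE hl).2 hr
      rw [sup_eq_left.2 ((Submodule.span_singleton_le_iff_mem _ _).2
        (Graph.sub_mem_incidenceSpan_iff.2 hr)), ← hrk, Matroid.rkNat, Matroid.rkNat,
        ← M.eRk_closure_eq, Matroid.closure_insert_eq_of_mem_closure hcl, M.eRk_closure_eq]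
    · have hcl := mt (h.mem_closure_iff hAE hl).1 hr
      rw [Submodule.finrank_sup_span_singleton_of_notMem
        (mt Graph.sub_mem_incidenceSpan_iff.1 hr), ← hrk, Matroid.rkNat,
        M.eRk_insert_eq_add_one ⟨heE, hcl⟩, ENat.toNat_add (M.eRk_coe_finset_ne_top A) (by simp)]
      rfl

theorem rkNat_add_one_eq_card (h : M.IsCycleMatroidOf G) {A : Finset α} (hA : (A : Set α) ⊆ M.E)
    {W : Finset V} {w : V} (hw : w ∈ W) (hAW : ∀ e ∈ A, ∀ x y, G.IsLink e x y → x ∈ W)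
    (hW : ∀ x ∈ W, (G.joinedBy (A : Set α)).Reachable w x) :
    M.rkNat (A : Set α) + 1 = W.card := by
  obtain ⟨hfin, hrk⟩ := h.rkNat_eq_finrank A hA
  rw [hrk]
  exact Graph.finrank_incidenceSpan_add_one hw hAW hW

/-- A loop is a one-element circuit, so no other circuit contains it and connectedness leaves room
for nothing else. -/
theorem eq_singleton_of_isLink (h : M.IsCycleMatroidOf G) {P : Set α} (hP : M.ConnectedOn P) {e : α}
    (he : e ∈ P) {x : V} (hx : G.IsLink e x x) : P = {e} := by
  have hC := (h.2 _).2 (Graph.isCycleEdgeSet_singleton hx)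
  refine (hP.2 {e} (by simpa using he) (by simp) fun C _ hC' hCe ↦ ?_).symm
  rw [Set.inter_singleton_nonempty] at hCe
  exact (hC.eq_of_subset_isCircuit hC' (by simpa using hCe)).ge

open Classical in
/-- In a graph whose cycle matroid is connected and loopless, removing at most one vertex leaves
the other non-isolated vertices connected. -/
theorem rkNat_filter_add_one_eq_card (h : M.IsCycleMatroidOf G) {P : Finset α}
    (hPE : (P : Set α) ⊆ M.E) (hP : M.ConnectedOn (P : Set α))
    (hloop : ∀ e ∈ P, ∀ x, ¬ G.IsLink e x x) {S : Finset V} (hS : (S : Set V) = G.vertexSet)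
    {T : Set V} (hT : T.Subsingleton) :
    M.rkNat (P.filter fun e ↦ ∀ x ∈ T, ¬ G.Inc e x : Finset α) + 1 =
      (S.filter fun x ↦ x ∉ T ∧ ∃ e ∈ P, G.Inc e x).card := by
  set A := P.filter fun e ↦ ∀ x ∈ T, ¬ G.Inc e x with hAdef
  set W := S.filter fun x ↦ x ∉ T ∧ ∃ e ∈ P, G.Inc e x with hWdef
  have hmemW : ∀ {x}, x ∈ W ↔ x ∉ T ∧ ∃ e ∈ P, G.Inc e x := fun {x} ↦ by
    rw [hWdef, Finset.mem_filter, and_iff_right_iff_imp]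
    rintro ⟨-, e, -, y, hl⟩
    have : x ∈ (S : Set V) := hS ▸ hl.left_mem
    exact this
  have hmemA : ∀ {e x y}, e ∈ P → G.IsLink e x y → x ∉ T → y ∉ T → e ∈ A :=
    fun {e x y} he hl hx hy ↦ by
      refine Finset.mem_filter.2 ⟨he, fun z hz hi ↦ ?_⟩
      rcases hi.eq_or_eq_of_isLink hl with rfl | rfl
      · exact hx hz
      · exact hy hz
  have hend : ∀ {e x y}, e ∈ P → G.IsLink e x y → x ∈ T → y ∉ T := fun {e x y} he hl hx hy ↦ by
    have := hT hx hy
    subst this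
    exact hloop e he x hl
  have hWne : ∃ w, w ∈ W := by
    obtain ⟨e, he⟩ := hP.1
    have he : e ∈ P := he
    obtain ⟨x, y, hl⟩ := h.exists_isLink (hPE he)
    by_cases hx : x ∈ T
    · exact ⟨y, hmemW.2 ⟨hend he hl hx, e, he, x, hl.symm⟩⟩
    · exact ⟨x, hmemW.2 ⟨hx, e, he, y, hl⟩⟩
  obtain ⟨w, hw⟩ := hWne
  -- The edges reachable from `w` while avoiding `T`. A cycle minus at most one vertex stays
  -- connected, so a circuit meeting `X` lies in `X`, and connectedness gives `X = P`.
  set X : Set α := {e | e ∈ P ∧ ∃ x y, G.IsLink e x y ∧ x ∉ T ∧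
    (G.joinedBy (A : Set α)).Reachable w x} with hX
  have hXP : X = (P : Set α) := by
    refine hP.2 X (fun e he ↦ he.1) ?_ ?_
    · obtain ⟨hwT, e, he, y, hl⟩ := hmemW.1 hw
      exact ⟨e, he, w, y, hl, hwT, .rfl⟩
    · rintro C hCP hC ⟨a, haC, haX⟩
      obtain ⟨n, v, f, hv, hf, hl, rfl⟩ := (h.2 C).1 hC
      have hfP : ∀ i, f i ∈ P := fun i ↦ hCP ⟨i, rfl⟩
      obtain ⟨m, hm⟩ : ∃ m, ∀ i, v i ∈ T → i = m := by
        by_cases hex : ∃ m, v m ∈ T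
        · obtain ⟨m, hm⟩ := hex
          exact ⟨m, fun i hi ↦ hv (hT hi hm)⟩
        · exact ⟨0, fun i hi ↦ (hex ⟨i, hi⟩).elim⟩
      -- The one cycle vertex that may lie in `T` borrows the component of its predecessor, so only
      -- the step out of `m` can fail.
      have key := Fin.eq_of_forall_ne_eq_add_one (m := m)
        (f := fun i ↦ (G.joinedBy (A : Set α)).connectedComponentMk
          (if v i ∈ T then v (i - 1) else v i)) (fun i hi ↦ by
            have hi' : v i ∉ T := fun h ↦ hi (hm i h)
            rw [if_neg hi']
            by_cases hi1 : v (i + 1) ∈ T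
            · rw [if_pos hi1, add_sub_cancel_right]
            · rw [if_neg hi1, SimpleGraph.ConnectedComponent.eq]
              exact (hl i).reachable (hmemA (hfP i) (hl i) hi' hi1))
      have key' : ∀ i j, v i ∉ T → v j ∉ T →
          (G.joinedBy (A : Set α)).Reachable (v i) (v j) := fun i j hi hj ↦ by
        have := key i j
        rwa [if_neg hi, if_neg hj, SimpleGraph.ConnectedComponent.eq] at this
      obtain ⟨j, hj, hjr⟩ : ∃ j, v j ∉ T ∧ (G.joinedBy (A : Set α)).Reachable w (v j) := by
        obtain ⟨j, rfl⟩ := haC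
        obtain ⟨-, x, y, hxy, hxT, hr⟩ := haX
        rcases hxy.left_eq_or_eq (hl j) with rfl | rfl
        · exact ⟨j, hxT, hr⟩
        · exact ⟨j + 1, hxT, hr⟩
      rintro _ ⟨i, rfl⟩
      refine ⟨hfP i, ?_⟩
      by_cases hi : v i ∈ T
      · have hi1 := hend (hfP i) (hl i) hi
        exact ⟨_, _, (hl i).symm, hi1, hjr.trans (key' _ _ hj hi1)⟩
      · exact ⟨_, _, hl i, hi, hjr.trans (key' _ _ hj hi)⟩
  have hAP : A ⊆ P := Finset.filter_subset _ _
  refine h.rkNat_add_one_eq_card (fun e he ↦ hPE (hAP he)) hw ?_ ?_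
  · intro e he x y hl
    obtain ⟨heP, heT⟩ := Finset.mem_filter.1 he
    exact hmemW.2 ⟨fun hx ↦ heT x hx ⟨y, hl⟩, e, heP, y, hl⟩
  · intro z hz
    obtain ⟨hzT, e, he, hez⟩ := hmemW.1 hz
    obtain ⟨-, x, y, hl, hx, hr⟩ : e ∈ X := hXP ▸ he
    rcases hez.eq_or_eq_of_isLink hl with rfl | rfl
    · exact hr
    · exact hr.trans (hl.reachable (hmemA he hl hx hzT))

end Matroid.IsCycleMatroidOf

/-! ### Counting components through vertex deletions, and the main theorem. -/

namespace Matroid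

variable {V α : Type*} {G : Graph V α} {M : Matroid α}

theorem coe_filter_subset_ground {A : Finset α} (hA : (A : Set α) ⊆ M.E) (p : α → Prop)
    [DecidablePred p] : ((A.filter p : Finset α) : Set α) ⊆ M.E :=
  (Finset.coe_subset.2 (Finset.filter_subset p A)).trans hA

/-- A partition of a finite set into the connected components of the matroid restricted to it. -/
theorem exists_connectedOn_partition_restrict (M : Matroid α) {A : Finset α}
    (hA : (A : Set α) ⊆ M.E) :
    ∃ f : α → ℕ, (∀ e ∈ A, f e < (M.restrict (A : Set α)).numComponents) ∧
      (∀ C ⊆ (A : Set α), M.IsCircuit C → ∀ x ∈ C, ∀ y ∈ C, f x = f y) ∧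
      ∀ i < (M.restrict (A : Set α)).numComponents,
        M.ConnectedOn ((A.filter (f · = i) : Finset α) : Set α) := by
  obtain ⟨f, hfE, hf, hconn⟩ := (M.restrict (A : Set α)).exists_connectedOn_partition
  refine ⟨f, fun e he ↦ ?_, fun C hCA hC ↦ hf C ((Matroid.restrict_isCircuit_iff hA).2 ⟨hC, hCA⟩),
    fun i hi ↦ ?_⟩
  · have : f e ∈ f '' (M.restrict (A : Set α)).E := ⟨e, he, rfl⟩
    rwa [hfE] at this
  · have hset : ((A.filter (f · = i) : Finset α) : Set α) =
        (M.restrict (A : Set α)).E ∩ f ⁻¹' {i} := by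
      ext e
      simp
    rw [hset]
    obtain ⟨hne, h⟩ := hconn i hi
    refine ⟨hne, fun X hX hXne hXC ↦ h X hX hXne fun C hCP hC ↦ hXC C hCP ?_⟩
    exact ((Matroid.restrict_isCircuit_iff hA).1 hC).1

/-- The alternating sum of ranks, Crapo's invariant up to sign, vanishes for disconnected
matroids. -/
theorem sum_alternating_rkNat_eq_zero {R : Finset α} (hR : (R : Set α) ⊆ M.E)
    (hne : R.Nonempty) (h : ¬ M.ConnectedOn (R : Set α)) :
    ∑ A ∈ R.powerset, (-1) ^ A.card * (M.rkNat (A : Set α) : ℤ) = 0 := by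
  classical
  simp only [ConnectedOn, Finset.coe_nonempty, hne, true_and, not_forall] at h
  obtain ⟨X, hXR, ⟨x, hx⟩, hXC, hXne⟩ := h
  obtain ⟨y, hyR, hyX⟩ := Set.exists_of_ssubset (hXR.ssubset_of_ne hXne)
  -- The rank splits into its parts inside and outside `X`; the first ignores `y`, the second
  -- ignores `x`, so both alternating sums vanish.
  let f : α → ℕ := fun e ↦ if e ∈ X then 0 else 1
  have hsum : ∀ A ⊆ R, (M.rkNat (A : Set α) : ℤ) =
      M.rkNat (A.filter (f · = 0) : Finset α) + M.rkNat (A.filter (f · = 1) : Finset α) := by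
    intro A hAR
    have hAR' : (A : Set α) ⊆ R := by exact_mod_cast hAR
    rw [M.rkNat_eq_sum (hAR'.trans hR) f 2 (fun e _ ↦ by simp only [f]; split_ifs <;> simp)
      fun C hCA hC a ha b hb ↦ ?_, Finset.sum_range_succ, Finset.sum_range_one, Nat.cast_add]
    have key : ∀ a ∈ C, ∀ b ∈ C, a ∈ X → b ∈ X := fun a ha b hb haX ↦
      hXC C (hCA.trans hAR') hC ⟨a, ha, haX⟩ hb
    simp only [f]
    by_cases haX : a ∈ X
    · rw [if_pos haX, if_pos (key a ha b hb haX)]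
    · rw [if_neg haX, if_neg fun h ↦ haX (key b hb a ha h)]
  have hfx : f x = 0 := if_pos hx
  have hfy : f y = 1 := if_neg hyX
  rw [Finset.sum_congr rfl fun A hA ↦ by rw [hsum A (Finset.mem_powerset.1 hA), mul_add],
    Finset.sum_add_distrib,
    Finset.sum_powerset_alternating_eq_zero (e := y) hyR
      (fun A ↦ (M.rkNat (A.filter (f · = 0) : Finset α) : ℤ)) fun A _ ↦ by
        rw [Finset.filter_insert, if_neg (by omega)],
    Finset.sum_powerset_alternating_eq_zero (e := x) (hXR hx)
      (fun A ↦ (M.rkNat (A.filter (f · = 1) : Finset α) : ℤ)) fun A _ ↦ by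
        rw [Finset.filter_insert, if_neg (by omega)], add_zero]

namespace IsCycleMatroidOf

open Classical in
theorem rkNat_add_one_eq_card_incident (h : M.IsCycleMatroidOf G) {P : Finset α}
    (hPE : (P : Set α) ⊆ M.E) (hP : M.ConnectedOn (P : Set α))
    (hloop : ∀ e ∈ P, ∀ x, ¬ G.IsLink e x x) {S : Finset V} (hS : (S : Set V) = G.vertexSet) :
    M.rkNat (P : Set α) + 1 = (S.filter fun x ↦ ∃ e ∈ P, G.Inc e x).card := by
  have := h.rkNat_filter_add_one_eq_card hPE hP hloop hS Set.subsingleton_empty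
  simpa using this

-- Compare the vertex counts for `T = ∅` and `T = {v}`: they differ by `v` alone, since the other
-- vertices stay connected.
open Classical in
theorem rkNat_filter_not_inc_add_one (h : M.IsCycleMatroidOf G) {P : Finset α}
    (hPE : (P : Set α) ⊆ M.E) (hP : M.ConnectedOn (P : Set α))
    (hloop : ∀ e ∈ P, ∀ x, ¬ G.IsLink e x x) {S : Finset V} (hS : (S : Set V) = G.vertexSet)
    {v : V} (hv : v ∈ S.filter fun x ↦ ∃ e ∈ P, G.Inc e x) :
    M.rkNat (P.filter fun e ↦ ¬ G.Inc e v : Finset α) + 1 = M.rkNat (P : Set α) := by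
  have h1 := h.rkNat_add_one_eq_card_incident hPE hP hloop hS
  have h2 := h.rkNat_filter_add_one_eq_card hPE hP hloop hS (Set.subsingleton_singleton (a := v))
  have h3 : (S.filter fun x ↦ x ∉ ({v} : Set V) ∧ ∃ e ∈ P, G.Inc e x) =
      (S.filter fun x ↦ ∃ e ∈ P, G.Inc e x).erase v := by
    ext x
    simp only [Finset.mem_filter, Finset.mem_erase, Set.mem_singleton_iff]
    tauto
  have h4 := Finset.card_erase_add_one hv
  simp only [Set.mem_singleton_iff, forall_eq] at h2
  simp only [Set.mem_singleton_iff] at h3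
  rw [h3] at h2
  omega

-- The one-component case of the formula for `c(A)`. Without loops the sum counts the `rk(P) + 1`
-- vertices met by `P`; with a loop, `P` is that loop and all ranks are zero.
open Classical in
theorem card_loops_sub_rkNat_add_sum (h : M.IsCycleMatroidOf G) {P : Finset α}
    (hPE : (P : Set α) ⊆ M.E) (hP : M.ConnectedOn (P : Set α)) {S : Finset V}
    (hS : (S : Set V) = G.vertexSet) :
    ((P.filter fun e ↦ ∃ x, G.IsLink e x x).card : ℤ) - M.rkNat (P : Set α) +
      ∑ v ∈ S, ((M.rkNat (P : Set α) : ℤ) -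
        M.rkNat (P.filter fun e ↦ ¬ G.Inc e v : Finset α)) = 1 := by
  by_cases hloop : ∀ e ∈ P, ∀ x, ¬ G.IsLink e x x
  · have h0 : (P.filter fun e ↦ ∃ x, G.IsLink e x x) = ∅ := by
      refine Finset.filter_eq_empty_iff.2 fun e he ↦ ?_
      rintro ⟨x, hx⟩
      exact hloop e he x hx
    have h1 := h.rkNat_add_one_eq_card_incident hPE hP hloop hS
    have h2 : ∑ v ∈ S, ((M.rkNat (P : Set α) : ℤ) -
        M.rkNat (P.filter fun e ↦ ¬ G.Inc e v : Finset α)) =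
        ∑ v ∈ S, if ∃ e ∈ P, G.Inc e v then 1 else 0 := by
      refine Finset.sum_congr rfl fun v hv ↦ ?_
      split_ifs with hinc
      · have := h.rkNat_filter_not_inc_add_one hPE hP hloop hS (Finset.mem_filter.2 ⟨hv, hinc⟩)
        omega
      · rw [Finset.filter_true_of_mem (p := fun e ↦ ¬ G.Inc e v) fun e he hi ↦ hinc ⟨e, he, hi⟩,
          sub_self]
    rw [h0, h2, Finset.sum_boole, ← h1]
    simp
  · push Not at hloop
    obtain ⟨e, he, x, hx⟩ := hloop
    have hPe : P = {e} := by
      have := h.eq_singleton_of_isLink hP (Finset.mem_coe.2 he) hx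
      exact_mod_cast this
    have hC := (h.2 _).2 (Graph.isCycleEdgeSet_singleton hx)
    have h0 : M.rkNat ((P : Finset α) : Set α) = 0 := by
      have := hC.eRk_add_one_eq
      rw [Set.encard_singleton, ← Finset.coe_singleton, ← coe_rkNat] at this
      rw [hPe]
      have : M.rkNat (({e} : Finset α) : Set α) + 1 = 1 := by exact_mod_cast this
      omega
    have h1 : ∀ v, M.rkNat (P.filter fun e ↦ ¬ G.Inc e v : Finset α) = 0 := fun v ↦ by
      have hle := M.eRk_mono (Finset.coe_subset.2 (Finset.filter_subset (fun e ↦ ¬ G.Inc e v) P))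
      have := ENat.toNat_le_toNat hle (M.eRk_coe_finset_ne_top P)
      exact Nat.le_zero.1 (this.trans h0.le)
    simp only [h0, h1]
    rw [Finset.filter_true_of_mem fun f hf ↦ ?_, hPe]
    · simp
    · rw [hPe, Finset.mem_singleton] at hf
      exact ⟨x, hf ▸ hx⟩

open Classical in
/-- The number of components of a set of edges in terms of loops and of the ranks of the graph and
of its vertex deletions. -/
theorem numComponents_restrict_eq (h : M.IsCycleMatroidOf G) {A : Finset α}
    (hA : (A : Set α) ⊆ M.E) {S : Finset V} (hS : (S : Set V) = G.vertexSet) :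
    ((M.restrict (A : Set α)).numComponents : ℤ) =
      ((A.filter fun e ↦ ∃ x, G.IsLink e x x).card : ℤ) - M.rkNat (A : Set α) +
        ∑ v ∈ S, ((M.rkNat (A : Set α) : ℤ) -
          M.rkNat (A.filter fun e ↦ ¬ G.Inc e v : Finset α)) := by
  obtain ⟨f, hfk, hf, hconn⟩ := M.exists_connectedOn_partition_restrict hA
  set k := (M.restrict (A : Set α)).numComponents
  have hsum : ∀ (p : α → Prop) [DecidablePred p], (M.rkNat (A.filter p : Finset α) : ℤ) =
      ∑ i ∈ Finset.range k, (M.rkNat ((A.filter (f · = i)).filter p : Finset α) : ℤ) := by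
    intro p _
    have hpA : A.filter p ⊆ A := Finset.filter_subset p A
    rw [M.rkNat_eq_sum (coe_filter_subset_ground hA p) f k (fun e he ↦ hfk e (hpA he))
      fun C hC ↦ hf C (hC.trans (Finset.coe_subset.2 hpA)), Nat.cast_sum]
    exact Finset.sum_congr rfl fun i _ ↦ by rw [Finset.filter_comm]
  have hrk : (M.rkNat (A : Set α) : ℤ) =
      ∑ i ∈ Finset.range k, (M.rkNat (A.filter (f · = i) : Finset α) : ℤ) := by
    have := hsum fun _ ↦ True
    simpa only [Finset.filter_true] using this
  have hcard : ((A.filter fun e ↦ ∃ x, G.IsLink e x x).card : ℤ) = ∑ i ∈ Finset.range k,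
      (((A.filter (f · = i)).filter fun e ↦ ∃ x, G.IsLink e x x).card : ℤ) := by
    rw [Finset.card_eq_sum_card_fiberwise (f := f) (t := Finset.range k)
      fun e he ↦ by simpa using hfk e (Finset.mem_filter.1 he).1, Nat.cast_sum]
    exact Finset.sum_congr rfl fun i _ ↦ by rw [Finset.filter_comm]
  have hvertex : ∑ v ∈ S, ((M.rkNat (A : Set α) : ℤ) -
      M.rkNat (A.filter fun e ↦ ¬ G.Inc e v : Finset α)) =
      ∑ i ∈ Finset.range k, ∑ v ∈ S, ((M.rkNat (A.filter (f · = i) : Finset α) : ℤ) -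
        M.rkNat ((A.filter (f · = i)).filter fun e ↦ ¬ G.Inc e v : Finset α)) := by
    rw [Finset.sum_comm]
    refine Finset.sum_congr rfl fun v _ ↦ ?_
    rw [hrk, hsum fun e ↦ ¬ G.Inc e v, Finset.sum_sub_distrib]
  rw [hvertex, hcard, hrk,
    ← Finset.sum_sub_distrib, ← Finset.sum_add_distrib,
    Finset.sum_congr rfl fun i hi ↦ h.card_loops_sub_rkNat_add_sum
      (coe_filter_subset_ground hA (f · = i)) (hconn i (Finset.mem_range.1 hi)) hS]
  simp

theorem betaRankIdentity_restrict (h : M.IsCycleMatroidOf G) (hV : G.vertexSet.Finite)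
    {R : Finset α} (hR : (R : Set α) ⊆ M.E) (hcard : 2 ≤ R.card) :
    (M.restrict (R : Set α)).BetaRankIdentity := by
  classical
  obtain ⟨S, hS⟩ := hV.exists_finset_coe
  rw [betaRankIdentity_restrict_iff]
  set b := ∑ A ∈ R.powerset, (-1) ^ A.card * (M.rkNat (A : Set α) : ℤ) with hb
  have hvertex : ∀ v, ∑ A ∈ R.powerset, (-1 : ℤ) ^ A.card * ((M.rkNat (A : Set α) : ℤ) -
      M.rkNat (A.filter fun e ↦ ¬ G.Inc e v : Finset α)) =
      if ∃ e ∈ R, G.Inc e v then b else 0 := by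
    intro v
    split_ifs with hinc
    · obtain ⟨e, he, hev⟩ := hinc
      -- Adding the edge `e` at `v` does not change the edges of `A` avoiding `v`, so the subtracted
      -- ranks cancel and `b` remains.
      rw [Finset.sum_congr rfl fun A _ ↦ mul_sub _ _ _, Finset.sum_sub_distrib,
        Finset.sum_powerset_alternating_eq_zero he
          (fun A ↦ (M.rkNat (A.filter fun e ↦ ¬ G.Inc e v : Finset α) : ℤ)) fun A _ ↦ by
            rw [Finset.filter_insert, if_neg (not_not.2 hev)], sub_zero]
    · refine Finset.sum_eq_zero fun A hA ↦ ?_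
      rw [Finset.filter_true_of_mem (p := fun e ↦ ¬ G.Inc e v) fun e he hi ↦
        hinc ⟨e, Finset.mem_powerset.1 hA he, hi⟩, sub_self, mul_zero]
  have halt : ∑ A ∈ R.powerset, (-1) ^ A.card * ((M.restrict (A : Set α)).numComponents : ℤ) =
      b * ((S.filter fun x ↦ ∃ e ∈ R, G.Inc e x).card - 1) := by
    rw [Finset.sum_congr rfl fun A hA ↦ by
      rw [h.numComponents_restrict_eq
        ((Finset.coe_subset.2 (Finset.mem_powerset.1 hA)).trans hR) hS, mul_add, mul_sub,
        Finset.mul_sum], Finset.sum_add_distrib, Finset.sum_sub_distrib, Finset.sum_comm,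
      Finset.sum_powerset_alternating_card_filter hcard,
      Finset.sum_congr rfl fun v _ ↦ hvertex v, ← Finset.sum_filter, Finset.sum_const, nsmul_eq_mul]
    ring
  rw [halt]
  by_cases hconn : M.ConnectedOn (R : Set α)
  · have hloop : ∀ e ∈ R, ∀ x, ¬ G.IsLink e x x := fun e he x hx ↦ by
      have := h.eq_singleton_of_isLink hconn (Finset.mem_coe.2 he) hx
      have hRe : R = {e} := by exact_mod_cast this
      rw [hRe, Finset.card_singleton] at hcard
      omega
    rw [← h.rkNat_add_one_eq_card_incident hR hconn hloop hS]
    push_cast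
    ring
  · have : b = 0 := sum_alternating_rkNat_eq_zero hR (Finset.card_pos.1 (by omega)) hconn
    rw [this, zero_mul, zero_mul]

end IsCycleMatroidOf

/-- The component identity holds for graphic matroids. -/
theorem IsGraphic.componentIdentity [M.Finite] (h : M.IsGraphic) : M.ComponentIdentity := by
  obtain ⟨G, hV, -, hG⟩ := h
  -- (2) is available for every restriction to at least two elements, so the equivalence gives (1)
  -- for the restriction to the whole ground set.
  have key := (M.forall_componentIdentity_iff M.elements).2 (fun R hR hcard ↦
    hG.betaRankIdentity_restrict hV (M.coe_elements ▸ Finset.coe_subset.2 hR) hcard)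
    M.elements subset_rfl
  rw [componentIdentity_iff] at key ⊢
  rw [elements_restrict] at key
  have hM : M.restrict (M.elements : Set α) = M := by rw [M.coe_elements, M.restrict_ground_eq_self]
  rwa [hM] at key

end Matroid

theorem mainTheorem5 {α : Type*} (M : Matroid α) [M.Finite] :
    ((M.IsGraphic ∨ M.IsCographic) →
      (M.numComponents : ℤ) = (M.elements.card : ℤ) -
        ∑ B ∈ M.elements.powerset, ∑ A ∈ B.powerset,
          (-1) ^ (B.card - A.card) * M.corank A * (M.rkNat B : ℤ)) ∧
    ((∀ R : Finset α, R ⊆ M.elements → (M.restrict (R : Set α)).ComponentIdentity) ↔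
      (∀ R : Finset α, R ⊆ M.elements → 2 ≤ R.card →
        (M.restrict (R : Set α)).BetaRankIdentity)) ∧
    (M.ComponentIdentity ↔ M.dual.ComponentIdentity) := by
  refine ⟨?_, M.forall_componentIdentity_iff M.elements, M.componentIdentity_dual_iff⟩
  rintro (h | h)
  · exact h.componentIdentity
  · exact M.componentIdentity_dual_iff.2 (Matroid.IsGraphic.componentIdentity h)
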